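/- Let $n\ge 1$, $\lambda>0$, and let $\mathbf d=(d(1),\dots,d(n))$ be a (random or deterministic) vector of non-negative integers, of arbitrary law, with $\sum_i d(i)$ even. Consider $n$ nodes, node $i$ carrying $d(i)$ half-edges. Given $\mathbf d$, consider the following two explorations. In both, all nodes are unexplored at time $0$; whenever $U>0$ nodes are unexplored, a new exponential clock of rate $\lambda U$, independent of everything else, is started, and when it rings a node $a$, uniform among the unexplored nodes, becomes active (and is no longer unexplored). The exploration ends when no unexplored node is left, and the jamming constant is the number of active nodes at that time divided by $n$. (1) Joint construction. At time $0$ all half-edges are unmatched. When $a$ becomes active, its unmatched half-edges are taken one by one (in any prescribed order, which may depend on the current matching) and each is matched with a half-edge chosen uniformly among all other half-edges that are unmatched at that moment (including those of $a$). The unexplored nodes other than $a$ that thereby share an edge with $a$ become blocked (and are no longer unexplored). Then these newly blocked nodes are taken one after the other in uniformly random order, and the remaining unmatched half-edges of each are matched in the same manner. Let $\mu^n_t=\sum_j\delta_{d_j(t)}$, the sum being over the nodes $j$ that are unexplored at time $t$, and $d_j(t)$ being the number of unmatched half-edges of $j$ at time $t$. (2) Parking process on the configuration model. First a realization $\tilde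 G$ of $\mathrm{CM}(n,\mathbf d)$ is drawn, the multigraph obtained from a uniformly random perfect matching of all half-edges, and it is then kept fixed. When $a$ becomes active, its neighbours in $\tilde G$ become blocked (and are no longer unexplored). Let $\tilde\mu^n_t=\sum_j\delta_{\tilde d_j(t)}$, the sum being over the nodes $j$ that are unexplored at time $t$, and $\tilde d_j(t)$ being the degree of $j$ in the sub-multigraph of $\tilde G$ induced by the unexplored nodes, edges being counted with multiplicity and loops twice. Then the measure-valued processes $(\tilde\mu^n_t)_{t\ge0}$ and $(\mu^n_t)_{t\ge0}$ have the same distribution, and the jamming constants of the two models have the same distribution. -/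

import Mathlib

open MeasureTheory ProbabilityTheory
open scoped NNReal ENNReal

noncomputable section

namespace Parking

/-! ### Half-edges, configuration model -/

/-- Node `i` carries `d i` half-edges; `h.1` is the ego of the half-edge `h`. -/
abbrev HalfEdge {n : ℕ} (d : Fin n → ℕ) : Type := Σ i : Fin n, Fin (d i)

/-- The half-edges of ego `i`. -/
def halfEdgesOf {n : ℕ} (d : Fin n → ℕ) (i : Fin n) : Finset (HalfEdge d) :=
  Finset.univ.filter fun h => h.1 = i

/-- Degree vectors on `n` nodes whose degrees have an even sum. -/
abbrev EvenDegreeVector (n : ℕ) : Type := {d : Fin n → ℕ // Even (∑ i, d i)}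

/-- The perfect matchings of the half-edges, as fixed-point free involutions. -/
def perfectMatchings {n : ℕ} (d : Fin n → ℕ) : Finset (HalfEdge d → HalfEdge d) :=
  Finset.univ.filter fun f => ∀ h, f (f h) = h ∧ f h ≠ h

theorem perfectMatchings_nonempty {n : ℕ} (d : EvenDegreeVector n) :
    (perfectMatchings d.1).Nonempty := by
  obtain ⟨m, hm⟩ := d.2
  have hc : Fintype.card (HalfEdge d.1) = Fintype.card (Fin m × Bool) := by
    simp [HalfEdge, Fintype.card_sigma, hm, mul_two]
  let e := Fintype.equivOfCardEq hc
  refine ⟨fun h => e.symm ((e h).1, !(e h).2), ?_⟩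
  simp only [perfectMatchings, Finset.mem_filter, Finset.mem_univ, true_and]
  intro h
  refine ⟨by simp, fun hh => ?_⟩
  have h2 := congrArg (fun x => (e x).2) hh
  simp at h2

/-- A multigraph on `n` nodes, given by its adjacency matrix: off the diagonal the entry is the
number of edges between two nodes, on the diagonal it is twice the number of loops. -/
abbrev MultiGraph (n : ℕ) : Type := Matrix (Fin n) (Fin n) ℕ

/-- The multigraph obtained by gluing matched half-edges: the entry `(i, j)` is the number of
half-edges of ego `i` that are matched with a half-edge of ego `j`. -/
def toMultiGraph {n : ℕ} (d : Fin n → ℕ) (f : HalfEdge d → HalfEdge d) : MultiGraph n :=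
  fun i j => ((halfEdgesOf d i).filter fun h => (f h).1 = j).card

/-- The configuration model: the multigraph of a uniform perfect matching of the half-edges. -/
def configurationModel {n : ℕ} (d : EvenDegreeVector n) : PMF (MultiGraph n) :=
  (PMF.uniformOfFinset (perfectMatchings d.1) (perfectMatchings_nonempty d)).map
    (toMultiGraph d.1)

/-! ### Exploration in continuous time

Both models are explorations: while there are `U > 0` unexplored nodes an exponential clock of rate
`lam * U`, independent of everything else, is set, and when it rings the state makes a random
transition. The exploration ends when no unexplored node is left. -/

/-- The state of the exploration initially and after each ring. -/
abbrev Run (S : Type) : Type := S × List S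

/-- The state after the `k`-th ring. -/
def Run.stateAt {S : Type} (r : Run S) (k : ℕ) : S := (r.1 :: r.2).getD k r.1

/-- The state at the end of the exploration. -/
def Run.final {S : Type} (r : Run S) : S := (r.1 :: r.2).getLast (List.cons_ne_nil _ _)

/-- The law of the states visited from `s` on, if `U` is the number of unexplored nodes and `step`
the transition at a ring. The numeral bounds the number of rings; each ring of the explorations
below removes an unexplored node, so that the number of nodes is a sufficient bound. -/
def runLaw {S : Type} (U : S → ℕ) (step : S → PMF S) : ℕ → S → PMF (Run S)
  | 0, s => PMF.pure (s, [])
  | m + 1, s =>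
    if U s = 0 then PMF.pure (s, [])
    else (step s).bind fun s' => (runLaw U step m s').map fun r => (s, r.1 :: r.2)

/-- The path of the observable `μ` along a run with waiting times `ξ`: at time `t` it is evaluated
at the state reached after the rings that occurred up to and including `t`. -/
def path {S : Type} (μ : S → Measure ℕ) (r : Run S) (ξ : Fin r.2.length → ℝ) :
    ℝ≥0 → Measure ℕ :=
  fun t => μ (r.stateAt
    (Finset.univ.filter fun k : Fin r.2.length => ∑ i ∈ Finset.Iic k, ξ i ≤ (t : ℝ)).card)

/-- The law of the measure-valued process `t ↦ μ (state at time t)`, on the path space with the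
`σ`-algebra generated by the coordinates. Given the visited states, the waiting times are
independent exponential variables of rate `lam` times the current number of unexplored nodes. -/
def processLaw {S : Type} (lam : ℝ) (U : S → ℕ) (μ : S → Measure ℕ) (run : PMF (Run S)) :
    Measure (ℝ≥0 → Measure ℕ) :=
  Measure.sum fun r : Run S => run r •
    (Measure.pi fun k : Fin r.2.length => expMeasure (lam * U (r.stateAt k))).map (path μ r)

/-! ### Joint construction of the graph and of the exploration -/

/-- A partial matching of the half-edges: the partner of each half-edge, if it has one. -/
abbrev PartialMatching {n : ℕ} (d : Fin n → ℕ) : Type := HalfEdge d → Option (HalfEdge d)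

/-- The half-edges of `F` that are still unmatched. -/
def unmatched {n : ℕ} {d : Fin n → ℕ} (p : PartialMatching d) (F : Finset (HalfEdge d)) :
    Finset (HalfEdge d) :=
  F.filter fun h => p h = none

/-- Match `h` and `h'` with each other. -/
def link {n : ℕ} {d : Fin n → ℕ} (p : PartialMatching d) (h h' : HalfEdge d) :
    PartialMatching d :=
  Function.update (Function.update p h (some h')) h' (some h)

/-- An arbitrary rule saying which one of a set of unmatched half-edges is treated next. -/
structure SelectionRule {n : ℕ} (d : Fin n → ℕ) where
  pick : PartialMatching d → (S : Finset (HalfEdge d)) → S.Nonempty → HalfEdge d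
  pick_mem : ∀ p S hS, pick p S hS ∈ S

instance {n : ℕ} (d : Fin n → ℕ) : Inhabited (SelectionRule d) :=
  ⟨⟨fun _ _ hS => hS.choose, fun _ _ hS => hS.choose_spec⟩⟩

/-- Match the unmatched half-edges of `F` one by one, each time with a uniform choice among all
other unmatched half-edges (a last half-edge without any possible match stays unmatched). Every
round treats an element of `F`, so that `F.card` rounds suffice. -/
def matchRounds {n : ℕ} {d : Fin n → ℕ} (ρ : SelectionRule d) (F : Finset (HalfEdge d)) :
    ℕ → PartialMatching d → PMF (PartialMatching d)
  | 0, p => PMF.pure p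
  | m + 1, p =>
    if hF : (unmatched p F).Nonempty then
      if hc : ((unmatched p Finset.univ).erase (ρ.pick p (unmatched p F) hF)).Nonempty then
        (PMF.uniformOfFinset _ hc).bind fun h' =>
          matchRounds ρ F m (link p (ρ.pick p (unmatched p F) hF) h')
      else PMF.pure p
    else PMF.pure p

/-- Match all unmatched half-edges of the node `i`. -/
def matchNode {n : ℕ} {d : Fin n → ℕ} (ρ : SelectionRule d) (i : Fin n)
    (p : PartialMatching d) : PMF (PartialMatching d) :=
  matchRounds ρ (halfEdgesOf d i) (halfEdgesOf d i).card p

/-- Match all unmatched half-edges of the nodes of `B`, node after node in uniform random order,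
for at most as many nodes as the numeral says. -/
def matchNodes {n : ℕ} {d : Fin n → ℕ} (ρ : SelectionRule d) :
    ℕ → Finset (Fin n) → PartialMatching d → PMF (PartialMatching d)
  | 0, _, p => PMF.pure p
  | m + 1, B, p =>
    if hB : B.Nonempty then
      (PMF.uniformOfFinset B hB).bind fun b =>
        (matchNode ρ b p).bind fun p' => matchNodes ρ m (B.erase b) p'
    else PMF.pure p

structure JointState {n : ℕ} (d : Fin n → ℕ) where
  matching : PartialMatching d
  unexplored : Finset (Fin n)
  active : Finset (Fin n)
  blocked : Finset (Fin n)

def JointState.init {n : ℕ} (d : Fin n → ℕ) : JointState d where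
  matching := fun _ => none
  unexplored := Finset.univ
  active := ∅
  blocked := ∅

/-- The unexplored nodes other than `a` that share an edge with `a`. -/
def newNeighbours {n : ℕ} {d : Fin n → ℕ} (p : PartialMatching d) (U : Finset (Fin n))
    (a : Fin n) : Finset (Fin n) :=
  (U.erase a).filter fun j => ∃ h h' : HalfEdge d, p h = some h' ∧ h.1 = a ∧ h'.1 = j

/-- A ring: a uniform unexplored node `a` becomes active; its unmatched half-edges are matched; the
unexplored nodes thereby attached to `a` become blocked; the unmatched half-edges of these are
matched. -/
def JointState.step {n : ℕ} {d : Fin n → ℕ} (ρ : SelectionRule d) (s : JointState d) :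
    PMF (JointState d) :=
  if hU : s.unexplored.Nonempty then
    (PMF.uniformOfFinset s.unexplored hU).bind fun a =>
      (matchNode ρ a s.matching).bind fun p =>
        (matchNodes ρ (newNeighbours p s.unexplored a).card
          (newNeighbours p s.unexplored a) p).map fun p' =>
            { matching := p'
              unexplored := s.unexplored.erase a \ newNeighbours p s.unexplored a
              active := insert a s.active
              blocked := s.blocked ∪ newNeighbours p s.unexplored a }
  else PMF.pure s

/-- The sum, over the unexplored nodes, of the Dirac masses at their numbers of unmatched
half-edges. -/
def JointState.degreeMeasure {n : ℕ} {d : Fin n → ℕ} (s : JointState d) : Measure ℕ :=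
  ∑ j ∈ s.unexplored, Measure.dirac (unmatched s.matching (halfEdgesOf d j)).card

def jointRunLaw {n : ℕ} {d : Fin n → ℕ} (ρ : SelectionRule d) : PMF (Run (JointState d)) :=
  runLaw (fun s => s.unexplored.card) (JointState.step ρ) n (JointState.init d)

/-- The law of the process of degrees of unexplored nodes in the joint construction. -/
def jointProcessLaw {n : ℕ} {d : Fin n → ℕ} (lam : ℝ) (ρ : SelectionRule d) :
    Measure (ℝ≥0 → Measure ℕ) :=
  processLaw lam (fun s => s.unexplored.card) JointState.degreeMeasure (jointRunLaw ρ)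

/-- The law of the jamming constant of the joint construction. -/
def jointJammingLaw {n : ℕ} {d : Fin n → ℕ} (ρ : SelectionRule d) : PMF ℝ :=
  (jointRunLaw ρ).map fun r => (r.final.active.card : ℝ) / n

/-! ### Parking process on a graph that is fixed beforehand -/

structure ParkingState (n : ℕ) where
  graph : MultiGraph n
  unexplored : Finset (Fin n)
  active : Finset (Fin n)
  blocked : Finset (Fin n)

def ParkingState.init {n : ℕ} (G : MultiGraph n) : ParkingState n where
  graph := G
  unexplored := Finset.univ
  active := ∅
  blocked := ∅

/-- The neighbours of `a` in `G`. -/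
def neighbours {n : ℕ} (G : MultiGraph n) (a : Fin n) : Finset (Fin n) :=
  Finset.univ.filter fun j => j ≠ a ∧ 0 < G a j

/-- A ring: a uniform unexplored node becomes active and its neighbours become blocked. -/
def ParkingState.step {n : ℕ} (s : ParkingState n) : PMF (ParkingState n) :=
  if hU : s.unexplored.Nonempty then
    (PMF.uniformOfFinset s.unexplored hU).map fun a =>
      { graph := s.graph
        unexplored := s.unexplored.erase a \ neighbours s.graph a
        active := insert a s.active
        blocked := s.blocked ∪ neighbours s.graph a }
  else PMF.pure s

/-- The sum, over the unexplored nodes, of the Dirac masses at their degrees in the sub-multigraph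
induced by the unexplored nodes (edges counted with multiplicity, loops twice). -/
def ParkingState.degreeMeasure {n : ℕ} (s : ParkingState n) : Measure ℕ :=
  ∑ j ∈ s.unexplored, Measure.dirac (∑ i ∈ s.unexplored, s.graph j i)

/-- First the graph is drawn from the configuration model, then it is explored. -/
def parkingRunLaw {n : ℕ} (d : EvenDegreeVector n) : PMF (Run (ParkingState n)) :=
  (configurationModel d).bind fun G =>
    runLaw (fun s => s.unexplored.card) ParkingState.step n (ParkingState.init G)

/-- The law of the process of degrees of unexplored nodes for the parking process on the
configuration model. -/
def parkingProcessLaw {n : ℕ} (lam : ℝ) (d : EvenDegreeVector n) :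
    Measure (ℝ≥0 → Measure ℕ) :=
  processLaw lam (fun s => s.unexplored.card) ParkingState.degreeMeasure (parkingRunLaw d)

/-- The law of the jamming constant of the parking process on the configuration model. -/
def parkingJammingLaw {n : ℕ} (d : EvenDegreeVector n) : PMF ℝ :=
  (parkingRunLaw d).map fun r => (r.final.active.card : ℝ) / n

end Parking

end

noncomputable section

/-! The proof is the principle of deferred decisions. If a partial matching is completed uniformly,
the partner of any prescribed unmatched half-edge is uniform among the other unmatched ones, and
given this partner the rest is again a uniform completion
(`Completable.completionLaw_eq_bind_link`). Hence revealing the half-edges of some nodes, in any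
order, and then completing uniformly yields the same perfect matching in law as completing at once
(`matchNode_spec`, `matchNodes_spec`).

The parking process on the configuration model can therefore be run on a matching that is revealed
only as needed. After each ring every half-edge of an explored node is matched and no edge between
unexplored nodes is revealed (`JointState.Admissible`). So the unmatched half-edges of an unexplored
node are exactly those that lead to unexplored nodes, for every completion
(`JointState.Admissible.observe_eq`), and the neighbours of a new active node are known once its
half-edges are matched (`erase_sdiff_neighbours`).

Induction on the number of rings (`map_observe_runLaw`) identifies the laws of the observed runs:
the number of unexplored nodes, which gives the clock rates, the degree measure and the number of
active nodes. These determine the two laws in the theorem. -/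

theorem PMF.bind_congr_of_support {α β : Type*} {p : PMF α} {f g : α → PMF β}
    (h : ∀ a ∈ p.support, f a = g a) : p.bind f = p.bind g := by
  ext b
  rw [PMF.bind_apply, PMF.bind_apply]
  refine tsum_congr fun a => ?_
  by_cases ha : a ∈ p.support
  · rw [h a ha]
  · rw [PMF.mem_support_iff, not_not] at ha
    simp [ha]

/-- A uniform choice in a finite set may be made in two stages: first the value of a map all of
whose fibres have the same cardinality, then a uniform element of the fibre. -/
theorem PMF.uniformOfFinset_eq_bind_fiber {α β : Type*} [DecidableEq α] [DecidableEq β] {s : Finset α}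
    (hs : s.Nonempty) {t : Finset β} (ht : t.Nonempty) (g : α → β)
    (hg : ∀ a ∈ s, g a ∈ t) (F : β → PMF α)
    (hF : ∀ b ∈ t, ∃ hb : (s.filter fun a => g a = b).Nonempty,
      F b = PMF.uniformOfFinset _ hb)
    (hcard : ∀ b ∈ t, ∀ c ∈ t,
      (s.filter fun a => g a = b).card = (s.filter fun a => g a = c).card) :
    PMF.uniformOfFinset s hs = (PMF.uniformOfFinset t ht).bind F := by
  ext a
  rw [PMF.bind_apply, PMF.uniformOfFinset_apply]
  have hval : ∀ b ∈ t, F b a =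
      if a ∈ s ∧ g a = b then ((s.filter fun a => g a = b).card : ℝ≥0∞)⁻¹ else 0 := by
    intro b hb
    obtain ⟨hne, h⟩ := hF b hb
    rw [h, PMF.uniformOfFinset_apply]
    simp
  by_cases ha : a ∈ s
  · have hga := hg a ha
    rw [tsum_eq_single (g a), hval _ hga, PMF.uniformOfFinset_apply, if_pos ha, if_pos hga,
      if_pos ⟨ha, rfl⟩]
    -- Double counting: equal fibres give `s.card` as a product, so the two uniform weights multiply
    -- to the right one.
    · have : s.card = t.card * (s.filter fun x => g x = g a).card := by
        rw [Finset.card_eq_sum_card_fiberwise (f := g) (t := t) (fun x hx => hg x hx),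
          Finset.sum_congr rfl fun b hb => hcard b hb (g a) hga]
        simp
      rw [this, Nat.cast_mul, ENNReal.mul_inv] <;> simp
    · intro b hb
      by_cases hbt : b ∈ t
      · rw [hval b hbt, if_neg fun h => hb h.2.symm, mul_zero]
      · rw [PMF.uniformOfFinset_apply, if_neg hbt, zero_mul]
  · rw [if_neg ha, eq_comm, ENNReal.tsum_eq_zero]
    intro b
    by_cases hbt : b ∈ t
    · rw [hval b hbt, if_neg fun h => ha h.1, mul_zero]
    · rw [PMF.uniformOfFinset_apply, if_neg hbt, zero_mul]

/-- A mixture of measures that depend on the mixing variable through `g` only is a mixture over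
the law of `g`. -/
theorem PMF.sum_smul_comp {α β Ω : Type*} [MeasurableSpace Ω] (p : PMF α) (g : α → β)
    (κ : β → Measure Ω) :
    (Measure.sum fun a => p a • κ (g a)) = Measure.sum fun b => p.map g b • κ b := by
  classical
  ext A hA
  simp only [Measure.sum_apply _ hA, Measure.smul_apply, smul_eq_mul, PMF.map_apply,
    ← ENNReal.tsum_mul_right]
  rw [ENNReal.tsum_comm]
  refine tsum_congr fun a => ?_
  rw [tsum_eq_single (g a) fun b hb => by simp [hb]]
  simp

namespace Parking

variable {n : ℕ} {d : Fin n → ℕ}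

/-! ### Uniform completions of a partial matching -/

/-- The perfect matchings that extend the partial matching `p`. -/
def completions (p : PartialMatching d) : Finset (HalfEdge d → HalfEdge d) :=
  (perfectMatchings d).filter fun f => ∀ h h', p h = some h' → f h = h'

theorem mem_completions {p : PartialMatching d} {f : HalfEdge d → HalfEdge d} :
    f ∈ completions p ↔
      (∀ h, f (f h) = h ∧ f h ≠ h) ∧ ∀ h h', p h = some h' → f h = h' := by
  simp [completions, perfectMatchings]

/-- A uniform perfect matching that extends `p` (the identity, if there is none). -/
def completionLaw (p : PartialMatching d) : PMF (HalfEdge d → HalfEdge d) :=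
  if hp : (completions p).Nonempty then PMF.uniformOfFinset _ hp else PMF.pure id

/-- A symmetric partial matching that extends to a perfect matching. -/
structure Completable (p : PartialMatching d) : Prop where
  symm : ∀ h h', p h = some h' → p h' = some h
  nonempty : (completions p).Nonempty

theorem mem_unmatched {p : PartialMatching d} {F : Finset (HalfEdge d)} {h : HalfEdge d} :
    h ∈ unmatched p F ↔ h ∈ F ∧ p h = none := by
  simp [unmatched]

theorem link_apply (p : PartialMatching d) (h h' x : HalfEdge d) :
    link p h h' x = if x = h' then some h else if x = h then some h' else p x := by
  simp [link, Function.update_apply]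

theorem Completable.mem_of_mem_support {p : PartialMatching d} (hp : Completable p)
    {f : HalfEdge d → HalfEdge d} (hf : f ∈ (completionLaw p).support) : f ∈ completions p := by
  rw [completionLaw, dif_pos hp.nonempty] at hf
  exact (PMF.mem_support_uniformOfFinset_iff _ _).1 hf

theorem Completable.apply_eq_none {p : PartialMatching d} (hp : Completable p)
    {f : HalfEdge d → HalfEdge d} (hf : f ∈ completions p) {h : HalfEdge d} (hh : p h = none) :
    p (f h) = none := by
  rw [mem_completions] at hf
  by_contra hne
  obtain ⟨y, hy⟩ := Option.ne_none_iff_exists'.1 hne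
  have h1 := hf.2 _ _ hy
  rw [(hf.1 h).1] at h1
  subst h1
  rw [hp.symm _ _ hy] at hh
  simp at hh

theorem completions_link {p : PartialMatching d} {h h' : HalfEdge d} (hh : p h = none)
    (hh' : p h' = none) (hne : h' ≠ h) :
    completions (link p h h') = (completions p).filter fun f => f h = h' := by
  ext f
  rw [Finset.mem_filter, mem_completions, mem_completions]
  constructor
  · rintro ⟨h1, h2⟩
    refine ⟨⟨h1, fun x y hxy => h2 x y ?_⟩, h2 h h' ?_⟩
    · rw [link_apply, if_neg, if_neg, hxy]
      · rintro rfl; simp [hh] at hxy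
      · rintro rfl; simp [hh'] at hxy
    · rw [link_apply, if_neg hne.symm, if_pos rfl]
  · rintro ⟨⟨h1, h2⟩, h3⟩
    refine ⟨h1, fun x y hxy => ?_⟩
    rw [link_apply] at hxy
    split_ifs at hxy with hx hx'
    · rw [hx, ← h3, (h1 h).1]
      exact Option.some.inj hxy
    · rw [hx', h3]
      exact Option.some.inj hxy
    · exact h2 x y hxy

/-- Conjugation by a transposition of two unmatched half-edges moves no pair already in `p`; this is
the symmetry behind uniformity. -/
theorem Completable.swap_mem {p : PartialMatching d} (hp : Completable p)
    {f : HalfEdge d → HalfEdge d} (hf : f ∈ completions p) {x y : HalfEdge d}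
    (hx : p x = none) (hy : p y = none) :
    (fun h => Equiv.swap x y (f (Equiv.swap x y h))) ∈ completions p := by
  have hfix : ∀ u, p u ≠ none → Equiv.swap x y u = u := fun u hu =>
    Equiv.swap_apply_of_ne_of_ne (fun e => hu (e ▸ hx)) (fun e => hu (e ▸ hy))
  rw [mem_completions] at hf ⊢
  refine ⟨fun h => ⟨by simp [(hf.1 _).1], fun e => (hf.1 (Equiv.swap x y h)).2 ?_⟩,
    fun u v huv => ?_⟩
  · simpa using congrArg (Equiv.swap x y) e
  · rw [hfix u (by simp [huv]), hf.2 u v huv, hfix v (by simp [hp.symm _ _ huv])]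

/-- Conjugation by the swap of `x` and `y` fixes `h`, so it injects one fibre into the other.
Exchanging `x` and `y` gives equality. -/
theorem Completable.card_fiber_le {p : PartialMatching d} (hp : Completable p)
    {h x y : HalfEdge d} (hx : p x = none) (hy : p y = none) (hxh : x ≠ h) (hyh : y ≠ h) :
    ((completions p).filter fun f => f h = x).card ≤
      ((completions p).filter fun f => f h = y).card := by
  refine Finset.card_le_card_of_injOn
    (fun f h => Equiv.swap x y (f (Equiv.swap x y h))) (fun f hf => ?_) (fun f _ g _ hfg => ?_)
  · rw [Finset.mem_coe, Finset.mem_filter] at hf ⊢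
    refine ⟨hp.swap_mem hf.1 hx hy, ?_⟩
    dsimp only
    rw [Equiv.swap_apply_of_ne_of_ne hxh.symm hyh.symm, hf.2, Equiv.swap_apply_left]
  · funext u
    simpa using congrFun hfg (Equiv.swap x y u)

theorem Completable.fiber_nonempty {p : PartialMatching d} (hp : Completable p)
    {h x : HalfEdge d} (hh : p h = none) (hx : p x = none) (hxh : x ≠ h) :
    ((completions p).filter fun f => f h = x).Nonempty := by
  obtain ⟨f, hf⟩ := hp.nonempty
  have hfh : f h ≠ h := ((mem_completions.1 hf).1 h).2
  have := hp.card_fiber_le (hp.apply_eq_none hf hh) hx hfh hxh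
  exact Finset.card_pos.1 ((Finset.card_pos.2 ⟨f, by simp [hf]⟩).trans_le this)

theorem Completable.link {p : PartialMatching d} (hp : Completable p) {h h' : HalfEdge d}
    (hh : p h = none) (hh' : p h' = none) (hne : h' ≠ h) : Completable (link p h h') where
  nonempty := by
    rw [completions_link hh hh' hne]
    exact hp.fiber_nonempty hh hh' hne
  symm x y hxy := by
    have := hp.symm x y
    simp only [link_apply] at hxy ⊢
    grind

/-- The partner of an unmatched half-edge in a uniform completion may be drawn first. -/
theorem Completable.completionLaw_eq_bind_link {p : PartialMatching d} (hp : Completable p)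
    {h : HalfEdge d} (hh : p h = none) (hc : ((unmatched p Finset.univ).erase h).Nonempty) :
    (PMF.uniformOfFinset _ hc).bind (fun h' => completionLaw (Parking.link p h h')) =
      completionLaw p := by
  have key : ∀ x, x ∈ (unmatched p Finset.univ).erase h ↔ x ≠ h ∧ p x = none := by
    simp [mem_unmatched]
  rw [completionLaw, dif_pos hp.nonempty]
  refine (PMF.uniformOfFinset_eq_bind_fiber hp.nonempty hc (fun f => f h) (fun f hf => ?_)
    _ (fun x hx => ?_) (fun x hx y hy => ?_)).symm
  · exact (key _).2 ⟨((mem_completions.1 hf).1 h).2, hp.apply_eq_none hf hh⟩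
  · rw [key] at hx
    refine ⟨hp.fiber_nonempty hh hx.2 hx.1, ?_⟩
    rw [completionLaw, dif_pos (hp.link hh hx.2 hx.1).nonempty]
    congr 1
    exact completions_link hh hx.2 hx.1
  · rw [key] at hx hy
    exact le_antisymm (hp.card_fiber_le hx.2 hy.2 hx.1 hy.1)
      (hp.card_fiber_le hy.2 hx.2 hy.1 hx.1)

/-- Any completion supplies a partner, so the branch of `matchRounds` without a possible match is
never taken from a completable matching. -/
theorem Completable.erase_unmatched_nonempty {p : PartialMatching d} (hp : Completable p)
    {h : HalfEdge d} (hh : p h = none) : ((unmatched p Finset.univ).erase h).Nonempty := by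
  obtain ⟨f, hf⟩ := hp.nonempty
  exact ⟨f h, by simp [mem_unmatched, hp.apply_eq_none hf hh, ((mem_completions.1 hf).1 h).2]⟩

/-! ### Matching the half-edges of nodes -/

/-- No two half-edges with egos in `V` are matched with each other. -/
def Separated (p : PartialMatching d) (V : Finset (Fin n)) : Prop :=
  ∀ h h', p h = some h' → h.1 ∈ V → h'.1 ∉ V

/-- `q` results from the completable matching `p` by matching half-edges of nodes in `B`. -/
structure Refines (B : Finset (Fin n)) (p q : PartialMatching d) : Prop where
  completable : Completable q
  extends_apply : ∀ h, p h ≠ none → q h = p h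
  separated : ∀ V, Disjoint B V → Separated p V → Separated q V

theorem Refines.refl {p : PartialMatching d} (hp : Completable p) (B : Finset (Fin n)) :
    Refines B p p := ⟨hp, fun _ _ => rfl, fun _ _ h => h⟩

theorem Refines.trans {B C : Finset (Fin n)} {p q r : PartialMatching d} (h : Refines B p q)
    (h' : Refines C q r) : Refines (B ∪ C) p r where
  completable := h'.completable
  extends_apply x hx := by
    rw [h'.extends_apply x (by rwa [h.extends_apply x hx]), h.extends_apply x hx]
  separated V hV hs := by
    rw [Finset.disjoint_union_left] at hV
    exact h'.separated V hV.2 (h.separated V hV.1 hs)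

theorem Refines.mono {B C : Finset (Fin n)} {p q : PartialMatching d} (h : Refines B p q)
    (hBC : B ⊆ C) : Refines C p q :=
  ⟨h.completable, h.extends_apply, fun V hV => h.separated V (hV.mono_left hBC)⟩

/-- The new pair has one ego `h.1` outside `V`, so it cannot join two nodes of `V`, whatever the
partner `h'` is. -/
theorem Refines.of_link {p : PartialMatching d} (hp : Completable p) {h h' : HalfEdge d}
    (hh : p h = none) (hh' : p h' = none) (hne : h' ≠ h) : Refines {h.1} p (link p h h') where
  completable := hp.link hh hh' hne
  extends_apply x hx := by
    rw [link_apply, if_neg, if_neg]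
    · rintro rfl; exact hx hh
    · rintro rfl; exact hx hh'
  separated V hV hs x y hxy hxV := by
    rw [Finset.disjoint_singleton_left] at hV
    have := hs x y
    rw [link_apply] at hxy
    grind

theorem mem_halfEdgesOf {i : Fin n} {h : HalfEdge d} : h ∈ halfEdgesOf d i ↔ h.1 = i := by
  simp [halfEdgesOf]

theorem matchRounds_spec (ρ : SelectionRule d) (i : Fin n) (m : ℕ) (p : PartialMatching d)
    (hp : Completable p) (hm : (unmatched p (halfEdgesOf d i)).card ≤ m) :
    (matchRounds ρ (halfEdgesOf d i) m p).bind completionLaw = completionLaw p ∧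
      ∀ q ∈ (matchRounds ρ (halfEdgesOf d i) m p).support,
        Refines {i} p q ∧ ∀ h, h.1 = i → q h ≠ none := by
  induction m generalizing p with
  | zero =>
    rw [Nat.le_zero, Finset.card_eq_zero] at hm
    refine ⟨PMF.pure_bind _ _, fun q hq => ?_⟩
    rw [matchRounds, PMF.mem_support_pure_iff] at hq
    subst hq
    refine ⟨.refl hp _, fun h hi hn => ?_⟩
    have : h ∈ unmatched q (halfEdgesOf d i) := mem_unmatched.2 ⟨mem_halfEdgesOf.2 hi, hn⟩
    simp [hm] at this
  | succ m ih =>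
    rw [matchRounds]
    by_cases hF : (unmatched p (halfEdgesOf d i)).Nonempty
    · rw [dif_pos hF]
      have hx := ρ.pick_mem p _ hF
      -- Only membership of the picked half-edge matters from here on, which is why the selection
      -- rule is arbitrary.
      generalize ρ.pick p _ hF = x at hx
      have hx' := mem_unmatched.1 hx
      have hxi := mem_halfEdgesOf.1 hx'.1
      have hc := hp.erase_unmatched_nonempty hx'.2
      rw [dif_pos hc]
      have step : ∀ y ∈ (PMF.uniformOfFinset _ hc).support, y ≠ x ∧ p y = none ∧
          (unmatched (link p x y) (halfEdgesOf d i)).card ≤ m := by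
        intro y hy
        rw [PMF.mem_support_uniformOfFinset_iff, Finset.mem_erase, mem_unmatched] at hy
        refine ⟨hy.1, hy.2.2, Nat.le_of_lt_succ (lt_of_lt_of_le (Finset.card_lt_card ?_) hm)⟩
        rw [Finset.ssubset_iff_of_subset]
        · exact ⟨x, hx, fun hmem => by
            have := (mem_unmatched.1 hmem).2
            rw [link_apply] at this
            grind⟩
        · intro z hz
          rw [mem_unmatched] at hz ⊢
          refine ⟨hz.1, ?_⟩
          have := hz.2
          rw [link_apply] at this
          grind
      constructor
      · rw [PMF.bind_bind, ← hp.completionLaw_eq_bind_link hx'.2 hc]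
        refine PMF.bind_congr_of_support fun y hy => ?_
        obtain ⟨h1, h2, h3⟩ := step y hy
        exact (ih _ (hp.link hx'.2 h2 h1) h3).1
      · intro q hq
        rw [PMF.mem_support_bind_iff] at hq
        obtain ⟨y, hy, hq⟩ := hq
        obtain ⟨h1, h2, h3⟩ := step y hy
        obtain ⟨h4, h5⟩ := (ih _ (hp.link hx'.2 h2 h1) h3).2 q hq
        have h6 := (Refines.of_link hp hx'.2 h2 h1).trans h4
        rw [hxi, Finset.union_self] at h6
        exact ⟨h6, h5⟩
    · rw [dif_neg hF]
      refine ⟨PMF.pure_bind _ _, fun q hq => ?_⟩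
      rw [PMF.mem_support_pure_iff] at hq
      subst hq
      exact ⟨.refl hp _, fun h hi hn =>
        hF ⟨h, mem_unmatched.2 ⟨mem_halfEdgesOf.2 hi, hn⟩⟩⟩

theorem matchNode_spec (ρ : SelectionRule d) (i : Fin n) (p : PartialMatching d)
    (hp : Completable p) :
    (matchNode ρ i p).bind completionLaw = completionLaw p ∧
      ∀ q ∈ (matchNode ρ i p).support, Refines {i} p q ∧ ∀ h, h.1 = i → q h ≠ none :=
  matchRounds_spec ρ i _ p hp (Finset.card_filter_le _ _)

theorem matchNodes_spec (ρ : SelectionRule d) (m : ℕ) (B : Finset (Fin n))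
    (p : PartialMatching d) (hp : Completable p) (hm : B.card = m) :
    (matchNodes ρ m B p).bind completionLaw = completionLaw p ∧
      ∀ q ∈ (matchNodes ρ m B p).support, Refines B p q ∧ ∀ h, h.1 ∈ B → q h ≠ none := by
  induction m generalizing p B with
  | zero =>
    rw [Finset.card_eq_zero] at hm
    refine ⟨PMF.pure_bind _ _, fun q hq => ?_⟩
    rw [matchNodes, PMF.mem_support_pure_iff] at hq
    subst hq hm
    exact ⟨.refl hp _, by simp⟩
  | succ m ih =>
    have hB : B.Nonempty := Finset.card_pos.1 (by omega)
    have hcard : ∀ b ∈ (PMF.uniformOfFinset B hB).support, (B.erase b).card = m := by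
      intro b hb
      rw [PMF.mem_support_uniformOfFinset_iff] at hb
      rw [Finset.card_erase_of_mem hb, hm, Nat.add_sub_cancel]
    rw [matchNodes, dif_pos hB]
    constructor
    · rw [PMF.bind_bind]
      -- For every first node `b` the resulting law is `completionLaw p`, so averaging over the
      -- random order changes nothing.
      refine Eq.trans (PMF.bind_congr_of_support fun b hb => ?_) (PMF.bind_const _ _)
      rw [PMF.bind_bind]
      refine Eq.trans (PMF.bind_congr_of_support fun q hq => ?_) (matchNode_spec ρ b p hp).1
      exact (ih _ q ((matchNode_spec ρ b p hp).2 q hq).1.completable (hcard b hb)).1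
    · intro q hq
      simp only [PMF.mem_support_bind_iff] at hq
      obtain ⟨b, hb, r, hr, hq⟩ := hq
      obtain ⟨h1, h2⟩ := (matchNode_spec ρ b p hp).2 r hr
      obtain ⟨h3, h4⟩ := (ih _ r h1.completable (hcard b hb)).2 q hq
      rw [PMF.mem_support_uniformOfFinset_iff] at hb
      refine ⟨(h1.trans h3).mono ?_, fun h hh => ?_⟩
      · rw [← Finset.insert_eq, Finset.insert_erase hb]
      · by_cases hhb : h.1 = b
        · rw [h3.extends_apply h (h2 h hhb)]
          exact h2 h hhb
        · exact h4 h (Finset.mem_erase.2 ⟨hhb, hh⟩)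

/-! ### Observables of an exploration -/

/-- Apply a map to all states of a run. -/
def Run.map {S T : Type} (φ : S → T) (r : Run S) : Run T := (φ r.1, r.2.map φ)

theorem Run.stateAt_map {S T : Type} (φ : S → T) (r : Run S) (k : ℕ) :
    (r.map φ).stateAt k = φ (r.stateAt k) := by
  simp only [Run.stateAt, Run.map, ← List.map_cons, List.getD_map]

theorem Run.final_map {S T : Type} (φ : S → T) (r : Run S) : (r.map φ).final = φ r.final := by
  simp only [Run.final, Run.map, ← List.map_cons, List.getLast_map]

theorem map_runLaw_cons {S T : Type} (φ : S → T) (s : S) (q : PMF (Run S)) :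
    (q.map fun r => (s, r.1 :: r.2)).map (Run.map φ) =
      (q.map (Run.map φ)).map fun r => (φ s, r.1 :: r.2) := by
  rw [PMF.map_comp, PMF.map_comp]
  rfl

theorem map_runLaw_succ {S T : Type} (φ : S → T) {U : S → ℕ} (step : S → PMF S) (m : ℕ) {s : S}
    (hs : U s ≠ 0) :
    (runLaw U step (m + 1) s).map (Run.map φ) =
      (step s).bind fun s' => ((runLaw U step m s').map (Run.map φ)).map
        fun r => (φ s, r.1 :: r.2) := by
  rw [runLaw, if_neg hs, PMF.map_bind]
  simp only [map_runLaw_cons]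

/-- The number of unexplored nodes, the degree measure and the number of active nodes. -/
def JointState.observe (s : JointState d) : ℕ × Measure ℕ × ℕ :=
  (s.unexplored.card, s.degreeMeasure, s.active.card)

/-- The number of unexplored nodes, the degree measure and the number of active nodes. -/
def ParkingState.observe (s : ParkingState n) : ℕ × Measure ℕ × ℕ :=
  (s.unexplored.card, s.degreeMeasure, s.active.card)

/-- The property of the states reached at the rings of the joint construction: the half-edges of
explored nodes are matched, those of unexplored nodes are unmatched or matched with half-edges of
explored nodes. -/
structure JointState.Admissible (s : JointState d) : Prop where
  completable : Completable s.matching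
  separated : Separated s.matching s.unexplored
  matched : ∀ h, h.1 ∉ s.unexplored → s.matching h ≠ none

/-! ### Degrees and neighbours that do not depend on the completion -/

theorem sum_toMultiGraph (f : HalfEdge d → HalfEdge d) (U : Finset (Fin n)) (j : Fin n) :
    ∑ i ∈ U, toMultiGraph d f j i = ((halfEdgesOf d j).filter fun h => (f h).1 ∈ U).card := by
  rw [Finset.card_eq_sum_card_fiberwise (f := fun h => (f h).1) (t := U)]
  · refine Finset.sum_congr rfl fun i hi => ?_
    rw [toMultiGraph, Finset.filter_filter]
    congr 1
    ext h
    simp only [Finset.mem_filter]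
    grind
  · intro h hh
    exact (Finset.mem_filter.1 hh).2

/-- For an admissible state, the degree of an unexplored node in the subgraph induced by the
unexplored nodes is its number of unmatched half-edges, whatever the completion. -/
theorem JointState.Admissible.observe_eq {s : JointState d} (hs : s.Admissible)
    {f : HalfEdge d → HalfEdge d} (hf : f ∈ completions s.matching) (B : Finset (Fin n)) :
    ParkingState.observe ⟨toMultiGraph d f, s.unexplored, s.active, B⟩ = s.observe := by
  have : ParkingState.degreeMeasure ⟨toMultiGraph d f, s.unexplored, s.active, B⟩ =
      s.degreeMeasure := by
    refine Finset.sum_congr rfl fun j hj => ?_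
    dsimp only at hj ⊢
    rw [sum_toMultiGraph, unmatched]
    congr 2
    refine Finset.filter_congr fun h hh => ?_
    rw [mem_halfEdgesOf] at hh
    constructor
    · intro hU
      by_contra hne
      obtain ⟨y, hy⟩ := Option.ne_none_iff_exists'.1 hne
      rw [(mem_completions.1 hf).2 h y hy] at hU
      exact hs.separated h y hy (hh ▸ hj) hU
    · intro hn
      by_contra hU
      -- The partner of an unmatched half-edge is unmatched, so its ego cannot be explored.
      exact hs.matched _ hU (hs.completable.apply_eq_none hf hn)
  simp only [ParkingState.observe, JointState.observe, this]

/-- Once the half-edges of `a` are matched, its neighbours do not depend on the completion. -/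
theorem erase_sdiff_neighbours {p : PartialMatching d} {a : Fin n}
    (hp : ∀ h, h.1 = a → p h ≠ none) {f : HalfEdge d → HalfEdge d} (hf : f ∈ completions p)
    (U : Finset (Fin n)) :
    U.erase a \ neighbours (toMultiGraph d f) a = U.erase a \ newNeighbours p U a := by
  have hf' := (mem_completions.1 hf).2
  ext j
  simp only [Finset.mem_sdiff, neighbours, newNeighbours, Finset.mem_filter, Finset.mem_univ,
    true_and, toMultiGraph, Finset.card_pos, Finset.Nonempty, mem_halfEdgesOf]
  -- `neighbours` may also contain explored nodes; the two sets agree only inside `U.erase a`.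
  refine and_congr_right fun hj => not_congr ?_
  constructor
  · rintro ⟨-, h, ha, hfj⟩
    obtain ⟨y, hy⟩ := Option.ne_none_iff_exists'.1 (hp h ha)
    exact ⟨hj, h, y, hy, ha, hf' h y hy ▸ hfj⟩
  · rintro ⟨-, h, y, hy, ha, hyj⟩
    exact ⟨(Finset.mem_erase.1 hj).1, h, ha, by rw [hf' h y hy, hyj]⟩

theorem JointState.Admissible.ring {ρ : SelectionRule d} {s : JointState d} (hs : s.Admissible)
    {a : Fin n} {p q : PartialMatching d}
    (hp : p ∈ (matchNode ρ a s.matching).support)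
    (hq : q ∈ (matchNodes ρ (newNeighbours p s.unexplored a).card
      (newNeighbours p s.unexplored a) p).support) :
    JointState.Admissible
      { matching := q
        unexplored := s.unexplored.erase a \ newNeighbours p s.unexplored a
        active := insert a s.active
        blocked := s.blocked ∪ newNeighbours p s.unexplored a } := by
  obtain ⟨h1, h2⟩ := (matchNode_spec ρ a _ hs.completable).2 p hp
  obtain ⟨h3, h4⟩ := (matchNodes_spec ρ _ _ p h1.completable rfl).2 q hq
  refine ⟨h3.completable, ?_, fun h hh => ?_⟩
  · refine h3.separated _ Finset.disjoint_sdiff (h1.separated _ ?_ ?_)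
    · simp
    · intro x y hxy hx hy
      simp only [Finset.mem_sdiff, Finset.mem_erase] at hx hy
      exact hs.separated x y hxy hx.1.2 hy.1.2
  · dsimp only at hh ⊢
    by_cases hN : h.1 ∈ newNeighbours p s.unexplored a
    · exact h4 h hN
    have hph : p h ≠ none := by
      by_cases ha : h.1 = a
      · exact h2 h ha
      · have hsh := hs.matched h fun hU => hh (by simp [hN, ha, hU])
        rwa [h1.extends_apply h hsh]
    rwa [h3.extends_apply h hph]

/-! ### Comparison of the runs by induction on the rings -/

theorem JointState.Admissible.map_observe_pure {s : JointState d} (hs : s.Admissible)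
    (B : (HalfEdge d → HalfEdge d) → Finset (Fin n)) :
    (PMF.pure (s, [])).map (Run.map JointState.observe) =
      (completionLaw s.matching).bind fun f => (PMF.pure
        ((⟨toMultiGraph d f, s.unexplored, s.active, B f⟩ : ParkingState n), [])).map
          (Run.map ParkingState.observe) := by
  refine ((PMF.bind_congr_of_support fun f hf => ?_).trans (PMF.bind_const _ _)).symm
  simp only [PMF.pure_map, Run.map, List.map_nil,
    hs.observe_eq (hs.completable.mem_of_mem_support hf)]

/-- From an admissible state on, the joint construction has the observables of the parking process
on the graph of a uniform completion. -/
theorem map_observe_runLaw (ρ : SelectionRule d) (m : ℕ) (s : JointState d) (hs : s.Admissible)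
    (B : (HalfEdge d → HalfEdge d) → Finset (Fin n)) :
    (runLaw (fun s => s.unexplored.card) (JointState.step ρ) m s).map
        (Run.map JointState.observe) =
      (completionLaw s.matching).bind fun f =>
        (runLaw (fun s => s.unexplored.card) ParkingState.step m
          ⟨toMultiGraph d f, s.unexplored, s.active, B f⟩).map (Run.map ParkingState.observe) := by
  induction m generalizing s B with
  | zero => exact hs.map_observe_pure B
  | succ m ih =>
    by_cases hU : s.unexplored.Nonempty
    swap
    · have h0 : s.unexplored.card = 0 := by simpa using hU
      simp only [runLaw, h0, if_true]
      exact hs.map_observe_pure B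
    have h0 : s.unexplored.card ≠ 0 := hU.card_ne_zero
    rw [map_runLaw_succ (U := fun s : JointState d => s.unexplored.card) _ _ _ h0]
    have hpark : ∀ f, (runLaw (fun s => s.unexplored.card) ParkingState.step (m + 1)
          (⟨toMultiGraph d f, s.unexplored, s.active, B f⟩ : ParkingState n)).map
            (Run.map ParkingState.observe) = _ :=
      fun f => map_runLaw_succ (U := fun s : ParkingState n => s.unexplored.card) _ _ _ h0
    simp only [hpark, ParkingState.step, JointState.step, dif_pos hU, PMF.bind_map, PMF.bind_bind,
      Function.comp_def]
    -- The active node is drawn independently of the completion, so it can be drawn first.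
    refine Eq.trans ?_ (PMF.bind_comm (PMF.uniformOfFinset s.unexplored hU)
      (completionLaw s.matching) _)
    congr 1
    funext a
    -- The completion is now revealed in the stages of the joint construction: the half-edges of
    -- `a`, then those of its new neighbours, then the rest.
    rw [← (matchNode_spec ρ a _ hs.completable).1, PMF.bind_bind]
    refine PMF.bind_congr_of_support fun p hp => ?_
    obtain ⟨h1, h2⟩ := (matchNode_spec ρ a _ hs.completable).2 p hp
    rw [← (matchNodes_spec ρ _ (newNeighbours p s.unexplored a) p h1.completable rfl).1,
      PMF.bind_bind]
    refine PMF.bind_congr_of_support fun q hq => ?_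
    obtain ⟨h3, -⟩ := (matchNodes_spec ρ _ _ p h1.completable rfl).2 q hq
    have had := hs.ring hp hq
    -- The blocked set on the parking side depends on the whole completion, hence the induction over
    -- an arbitrary `B`; the observables ignore it.
    rw [ih _ had (fun f => B f ∪ neighbours (toMultiGraph d f) a), PMF.map_bind]
    refine PMF.bind_congr_of_support fun f hf => ?_
    have hfq := h3.completable.mem_of_mem_support hf
    have hext : ∀ {p q : PartialMatching d} {B : Finset (Fin n)}, Refines B p q →
        f ∈ completions q → f ∈ completions p := fun h hf => by
      rw [mem_completions] at hf ⊢
      exact ⟨hf.1, fun x y hxy => hf.2 x y (by rw [h.extends_apply x (by simp [hxy]), hxy])⟩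
    have hfp := hext h3 hfq
    rw [erase_sdiff_neighbours h2 hfp, hs.observe_eq (hext h1 hfp)]

theorem admissible_init (d : EvenDegreeVector n) : (JointState.init d.1).Admissible where
  completable := ⟨by simp [JointState.init], by
    simpa [completions, JointState.init] using perfectMatchings_nonempty d⟩
  separated := by simp [Separated, JointState.init]
  matched := by simp [JointState.init]

theorem map_observe_jointRunLaw (d : EvenDegreeVector n) (ρ : SelectionRule d.1) :
    (jointRunLaw ρ).map (Run.map JointState.observe) =
      (parkingRunLaw d).map (Run.map ParkingState.observe) := by
  have hc : completions (JointState.init d.1).matching = perfectMatchings d.1 := by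
    simp [completions, JointState.init]
  have hlaw : completionLaw (JointState.init d.1).matching =
      PMF.uniformOfFinset (perfectMatchings d.1) (perfectMatchings_nonempty d) := by
    rw [completionLaw, dif_pos (admissible_init d).completable.nonempty]
    congr 1
  rw [jointRunLaw, map_observe_runLaw ρ n _ (admissible_init d) fun _ => ∅, hlaw, parkingRunLaw,
    configurationModel, PMF.bind_map, PMF.map_bind]
  rfl

/-! ### The laws of the observables determine the laws of the process and of the jamming constant -/

/-- Rates and path values are functions of the observed states, and observing keeps the number of
rings; so the mixture over runs is one over observed runs. -/
theorem processLaw_eq_of_observe {S : Type} (lam : ℝ) (U : S → ℕ) (μ : S → Measure ℕ)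
    (φ : S → ℕ × Measure ℕ × ℕ) (hU : ∀ s, (φ s).1 = U s) (hμ : ∀ s, (φ s).2.1 = μ s)
    (run : PMF (Run S)) :
    processLaw lam U μ run =
      processLaw lam (fun o => o.1) (fun o => o.2.1) (run.map (Run.map φ)) := by
  rw [processLaw, processLaw, ← PMF.sum_smul_comp run (Run.map φ) fun r =>
    (Measure.pi fun k : Fin r.2.length => expMeasure (lam * (r.stateAt k).1)).map
      (path (fun o => o.2.1) r)]
  congr 1
  funext r
  congr 1
  -- The mapped run has the same length only propositionally, so the product measures live on
  -- different types and are transported along `L = L'`.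
  have key : ∀ (L L' : ℕ) (_ : L = L') (u : ℕ → ℕ) (ν : ℕ → Measure ℕ),
      (Measure.pi fun k : Fin L => expMeasure (lam * u k)).map
          (fun ξ (t : ℝ≥0) => ν (Finset.univ.filter fun k : Fin L =>
            ∑ i ∈ Finset.Iic k, ξ i ≤ (t : ℝ)).card) =
        (Measure.pi fun k : Fin L' => expMeasure (lam * u k)).map
          (fun ξ (t : ℝ≥0) => ν (Finset.univ.filter fun k : Fin L' =>
            ∑ i ∈ Finset.Iic k, ξ i ≤ (t : ℝ)).card) := by
    rintro L _ rfl u ν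
    rfl
  have := key _ _ (List.length_map (as := r.2) φ).symm (fun k => U (r.stateAt k))
    fun k => μ (r.stateAt k)
  unfold path
  simp only [Run.stateAt_map, hU, hμ]
  exact this

theorem parkingProcessLaw_eq_jointProcessLaw (lam : ℝ) (d : EvenDegreeVector n)
    (ρ : SelectionRule d.1) : parkingProcessLaw lam d = jointProcessLaw lam ρ := by
  rw [parkingProcessLaw, jointProcessLaw,
    processLaw_eq_of_observe lam (fun s : ParkingState n => s.unexplored.card)
      ParkingState.degreeMeasure ParkingState.observe (fun _ => rfl) (fun _ => rfl),
    processLaw_eq_of_observe lam (fun s : JointState d.1 => s.unexplored.card)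
      JointState.degreeMeasure JointState.observe (fun _ => rfl) (fun _ => rfl),
    map_observe_jointRunLaw]

theorem parkingJammingLaw_eq_jointJammingLaw (d : EvenDegreeVector n) (ρ : SelectionRule d.1) :
    parkingJammingLaw d = jointJammingLaw ρ := by
  have h := congrArg (PMF.map fun r : Run (ℕ × Measure ℕ × ℕ) => (r.final.2.2 : ℝ) / n)
    (map_observe_jointRunLaw d ρ)
  rw [PMF.map_comp, PMF.map_comp] at h
  simp only [Function.comp_def, Run.final_map] at h
  exact h.symm

end Parking

end

/-- `D` is the law of the random degree vector; a deterministic degree vector `d` is the case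
`D = PMF.pure d`. Both laws are mixtures over the degree vector. -/
theorem mainTheorem5 (n : ℕ) (hn : 0 < n) (lam : ℝ) (hlam : 0 < lam)
    (ρ : ∀ d : Parking.EvenDegreeVector n, Parking.SelectionRule d.1)
    (D : PMF (Parking.EvenDegreeVector n)) :
    (Measure.sum fun d => D d • Parking.parkingProcessLaw lam d) =
        (Measure.sum fun d => D d • Parking.jointProcessLaw lam (ρ d)) ∧
      (D.bind fun d => Parking.parkingJammingLaw d) =
        (D.bind fun d => Parking.jointJammingLaw (ρ d)) := by
  constructor
  · congr 1
    funext d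
    rw [Parking.parkingProcessLaw_eq_jointProcessLaw lam d (ρ d)]
  · congr 1
    funext d
    rw [Parking.parkingJammingLaw_eq_jointJammingLaw d (ρ d)]
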